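/- Let $1\le k\le n$. For $A\in\mathbb R^{n\times m}$ let $A^{(k)}$ denote the $k$th multiplicative compound, i.e. the $\binom nk\times\binom mk$ matrix of all minors of order $k$ of $A$, and for $A\in\mathbb R^{n\times n}$ let $A^{[k]}:=\frac{d}{d\varepsilon}(I+\varepsilon A)^{(k)}\big|_{\varepsilon=0}$ be its $k$th additive compound. For $v^1,\dots,v^k\in\mathbb R^n$ put $v^1\wedge\dots\wedge v^k:=[\,v^1\ \cdots\ v^k\,]^{(k)}\in\mathbb R^{\binom nk}$. For a norm $|\cdot|$ on $\mathbb R^{q}$, with induced matrix norm $\|A\|=\max_{|x|=1}|Ax|$, the induced matrix measure is $\mu(A)=\lim_{\varepsilon\downarrow0}\frac{\|I+\varepsilon A\|-1}{\varepsilon}$ for $A\in\mathbb R^{q\times q}$. Consider the time-varying system $\dot x=f(t,x)$, $f:[0,\infty)\times\mathbb R^n\to\mathbb R^n$, where $f$ is continuously differentiable with respect to $x$, that is, the Jacobian $J(t,x)=\frac{\partial f}{\partial x}(t,x)$ exists and is continuous on $[0,\infty)\times\mathbb R^n$. Let $\Omega\subseteq\mathbb R^n$ be closed and convex, and suppose that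 for every $a\in\Omega$ the (necessarily unique) solution $x(t,a)$ with $x(0,a)=a$ exists and satisfies $x(t,a)\in\Omega$ for all $t\ge0$. Let $S^k=\{r\in\mathbb R^k: r_i\ge0,\ r_1+\dots+r_k\le1\}$. For $a^1,\dots,a^{k+1}\in\Omega$ and $r\in S^k$ let $h(r)=\sum_{i=1}^k r_ia^i+\bigl(1-\sum_{i=1}^k r_i\bigr)a^{k+1}$ and $$w^i(t,r)=\frac{\partial}{\partial r_i}x(t,h(r)),\qquad i=1,\dots,k,$$ where the partial derivatives are those given by the derivative of $r\mapsto x(t,h(r))$ relative to $S^k$. The system is called $k$-order contractive if there are $\eta>0$ and a norm $|\cdot|$ on $\mathbb R^{\binom nk}$ such that, for all $a^1,\dots,a^{k+1}\in\Omega$, all $r\in S^k$ and all $t\ge0$, these derivatives exist and $$\bigl|w^1(t,r)\wedge\dots\wedge w^k(t,r)\bigr|\le e^{-\eta t}\,\bigl|w^1(0,r)\wedge\dots\wedge w^k(0,r)\bigr|.\qquad(*)$$ **Proposition.** Suppose that there exist $\eta>0$ and a norm $|\cdot|$ on $\mathbb R^{\binom nk}$, with induced matrix measure $\mu$, such that $\mu\bigl(J^{[k]}(t,a)\bigr)\le-\eta$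 for all $t\ge0$ and all $a\in\Omega$, where $J^{[k]}(t,a)=(J(t,a))^{[k]}$. Then the derivatives $w^i$ exist and $(*)$ holds with this same $\eta$ and this same norm, for all $a^1,\dots,a^{k+1}\in\Omega$, all $r\in S^k$ and all $t\ge0$. In particular, the system is $k$-order contractive. -/

import Mathlib

namespace KContraction

noncomputable section

/-! ### Compound matrices and wedge products -/

/-- The `k`-th multiplicative compound `A^(k)` of an `n × m` matrix: the matrix of all minors of
order `k`.  Increasing sequences of `k` indices from `[1,n]` are the order embeddings
`Fin k ↪o Fin n` (there are `n.choose k` of them). -/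
def multCompound (k : ℕ) {n m : ℕ} (A : Matrix (Fin n) (Fin m) ℝ) :
    Matrix (Fin k ↪o Fin n) (Fin k ↪o Fin m) ℝ :=
  fun κ κ' => (A.submatrix κ κ').det

/-- The `k`-th additive compound `A^[k] = d/dε (I + ε A)^(k) |_{ε = 0}`, the derivative being
taken entrywise (every entry is a polynomial in `ε`). -/
def additiveCompound (k : ℕ) {n : ℕ} (A : Matrix (Fin n) (Fin n) ℝ) :
    Matrix (Fin k ↪o Fin n) (Fin k ↪o Fin n) ℝ :=
  fun κ κ' => deriv (fun ε : ℝ => multCompound k (1 + ε • A) κ κ') 0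

/-- The wedge product `v 0 ∧ ⋯ ∧ v (k-1)` of `k` vectors of `ℝⁿ`: the `k`-th multiplicative
compound of the `n × k` matrix with columns `v i`.  This compound has a single column, indexed by
the identity embedding, so it is read as a vector of dimension `n.choose k`. -/
def wedge {k n : ℕ} (v : Fin k → Fin n → ℝ) : (Fin k ↪o Fin n) → ℝ :=
  fun κ => multCompound k (Matrix.of fun j i => v i j) κ (RelEmbedding.refl _)

/-! ### Vector norms, induced matrix norms, induced matrix measures -/

/-- A vector norm on `ℝ^ι`: a seminorm vanishing only at the origin. -/
def IsVectorNorm {ι : Type*} (N : Seminorm ℝ (ι → ℝ)) : Prop :=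
  ∀ v : ι → ℝ, N v = 0 → v = 0

/-- The matrix norm induced by the vector norm `N`: the maximum of `N (A x)` over `N x = 1`. -/
def inducedNorm {ι : Type*} [Fintype ι] (N : Seminorm ℝ (ι → ℝ)) (A : Matrix ι ι ℝ) : ℝ :=
  sSup {c : ℝ | ∃ v : ι → ℝ, N v = 1 ∧ c = N (A.mulVec v)}

/-- The matrix measure (logarithmic norm) induced by the vector norm `N`:
`μ(A) = lim_{ε ↓ 0} (‖I + ε A‖ - 1) / ε`.  The limit exists by `tendsto_matrixMeasure`. -/
def matrixMeasure {ι : Type*} [Fintype ι] [DecidableEq ι] (N : Seminorm ℝ (ι → ℝ))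
    (A : Matrix ι ι ℝ) : ℝ :=
  Filter.limUnder (nhdsWithin (0 : ℝ) (Set.Ioi 0)) fun ε : ℝ => (inducedNorm N (1 + ε • A) - 1) / ε

theorem seminorm_bound {E : Type*} [AddCommGroup E] [Module ℝ E] [FiniteDimensional ℝ E]
    (N : Seminorm ℝ E) (hN : ∀ v, N v = 0 → v = 0) (T : E →ₗ[ℝ] E) :
    ∃ C : ℝ, ∀ v, N (T v) ≤ C * N v := by
  let _ : Norm E := ⟨N⟩
  have core : NormedSpace.Core ℝ E :=
    { norm_nonneg := fun x => apply_nonneg N x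
      norm_smul := fun c x => map_smul_eq_mul N c x
      norm_triangle := fun x y => map_add_le_add N x y
      norm_eq_zero_iff := fun x => ⟨hN x, fun h => by subst h; exact map_zero N⟩ }
  let _ : NormedAddCommGroup E := NormedAddCommGroup.ofCore core
  let _ : NormedSpace ℝ E := NormedSpace.ofCore core
  exact ⟨‖LinearMap.toContinuousLinearMap T‖,
    fun v => (LinearMap.toContinuousLinearMap T).le_opNorm v⟩

theorem bddAbove_inducedNorm {ι : Type*} [Fintype ι] (N : Seminorm ℝ (ι → ℝ))
    (hN : IsVectorNorm N) (A : Matrix ι ι ℝ) :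
    BddAbove {c : ℝ | ∃ v : ι → ℝ, N v = 1 ∧ c = N (A.mulVec v)} := by
  obtain ⟨C, hC⟩ := seminorm_bound N hN A.mulVecLin
  refine ⟨C, ?_⟩
  rintro c ⟨v, hv, rfl⟩
  simpa [hv] using hC v

/-- The limit that defines the matrix measure exists. -/
theorem tendsto_matrixMeasure {ι : Type*} [Fintype ι] [DecidableEq ι] [Nonempty ι]
    (N : Seminorm ℝ (ι → ℝ)) (hN : IsVectorNorm N) (A : Matrix ι ι ℝ) :
    Filter.Tendsto (fun ε : ℝ => (inducedNorm N (1 + ε • A) - 1) / ε)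
      (nhdsWithin (0 : ℝ) (Set.Ioi 0)) (nhds (matrixMeasure N A)) := by
  obtain ⟨u, hu⟩ : ∃ u : ι → ℝ, N u = 1 := by
    obtain ⟨w, hw⟩ := exists_ne (0 : ι → ℝ)
    have hw' : N w ≠ 0 := fun h => hw (hN w h)
    refine ⟨(N w)⁻¹ • w, ?_⟩
    rw [map_smul_eq_mul, norm_inv, Real.norm_of_nonneg (apply_nonneg N w), inv_mul_cancel₀ hw']
  have hconv : ConvexOn ℝ Set.univ (fun ε : ℝ => inducedNorm N (1 + ε • A)) := by
    refine ⟨convex_univ, fun ε₁ _ ε₂ _ a b ha hb hab => ?_⟩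
    refine csSup_le ⟨_, u, hu, rfl⟩ ?_
    rintro c ⟨v, hv, rfl⟩
    have h1 : N ((1 + ε₁ • A).mulVec v) ≤ inducedNorm N (1 + ε₁ • A) :=
      le_csSup (bddAbove_inducedNorm N hN _) ⟨v, hv, rfl⟩
    have h2 : N ((1 + ε₂ • A).mulVec v) ≤ inducedNorm N (1 + ε₂ • A) :=
      le_csSup (bddAbove_inducedNorm N hN _) ⟨v, hv, rfl⟩
    have h3 : (1 + (a • ε₁ + b • ε₂) • A).mulVec v
        = a • (1 + ε₁ • A).mulVec v + b • (1 + ε₂ • A).mulVec v := by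
      simp only [Matrix.add_mulVec, Matrix.one_mulVec, Matrix.smul_mulVec, smul_add, smul_eq_mul,
        add_smul, mul_smul]
      nth_rewrite 1 [← one_smul ℝ v]
      rw [← hab, add_smul]
      abel
    rw [h3]
    refine (map_add_le_add N _ _).trans ?_
    rw [map_smul_eq_mul, map_smul_eq_mul, Real.norm_of_nonneg ha, Real.norm_of_nonneg hb]
    simp only [smul_eq_mul]
    gcongr
  have h0 : inducedNorm N (1 + (0 : ℝ) • A) = 1 := by
    have : {c : ℝ | ∃ v : ι → ℝ, N v = 1 ∧ c = N ((1 + (0 : ℝ) • A).mulVec v)} = {1} := by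
      ext c
      simp only [zero_smul, add_zero, Matrix.one_mulVec, Set.mem_singleton_iff]
      exact ⟨fun ⟨v, hv, hc⟩ => hc.trans hv, fun hc => ⟨u, hu, hc.trans hu.symm⟩⟩
    rw [inducedNorm, this, csSup_singleton]
  have hd := (hconv.hasDerivWithinAt_rightDeriv_of_mem_interior (x := 0) (by simp))
  rw [hasDerivWithinAt_iff_tendsto_slope' (by simp)] at hd
  refine _root_.tendsto_nhds_limUnder ⟨_, hd.congr fun ε => ?_⟩
  rw [slope_def_field, h0, sub_zero]

/-! ### The system `ẋ = f(t, x)` -/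

/-- `f(t, x)` (for `t ≥ 0`, `x ∈ ℝⁿ`) is continuously differentiable with respect to `x`:
`∂f/∂x` exists and is continuous on `[0, ∞) × ℝⁿ`. -/
def IsC1InState {n : ℕ} (f : ℝ → (Fin n → ℝ) → (Fin n → ℝ)) : Prop :=
  (∀ t : ℝ, 0 ≤ t → Differentiable ℝ (f t)) ∧
  ContinuousOn (fun p : ℝ × (Fin n → ℝ) => fderiv ℝ (f p.1) p.2) (Set.Ici (0 : ℝ) ×ˢ Set.univ)

/-- The Jacobian matrix `J(t, x) = ∂f/∂x (t, x)`. -/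
def jacobian {n : ℕ} (f : ℝ → (Fin n → ℝ) → (Fin n → ℝ)) (t : ℝ) (x : Fin n → ℝ) :
    Matrix (Fin n) (Fin n) ℝ :=
  LinearMap.toMatrix' (fderiv ℝ (f t) x : (Fin n → ℝ) →ₗ[ℝ] (Fin n → ℝ))

/-- `x t a` is the solution at time `t ≥ 0` of `ẋ = f(t, x)` with initial condition `a ∈ Ω` at
time `0`, and it stays in `Ω`. -/
def IsSolutionMap {n : ℕ} (f : ℝ → (Fin n → ℝ) → (Fin n → ℝ)) (Ω : Set (Fin n → ℝ))
    (x : ℝ → (Fin n → ℝ) → (Fin n → ℝ)) : Prop :=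
  ∀ a ∈ Ω, x 0 a = a ∧ IsIntegralCurveOn (fun t => x t a) f (Set.Ici 0) ∧
    ∀ t : ℝ, 0 ≤ t → x t a ∈ Ω

/-! ### `k`-order contraction -/

/-- The unit simplex `S^k = {r ∈ ℝ^k | r_i ≥ 0, r_1 + ⋯ + r_k ≤ 1}`. -/
def unitSimplex (k : ℕ) : Set (Fin k → ℝ) :=
  {r | (∀ i, 0 ≤ r i) ∧ ∑ i, r i ≤ 1}

/-- The convex combination `h(r) = ∑_{i ≤ k} r_i a^i + (1 - ∑_{i ≤ k} r_i) a^{k+1}`. -/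
def convexComb {k n : ℕ} (a : Fin (k + 1) → Fin n → ℝ) (r : Fin k → ℝ) : Fin n → ℝ :=
  (∑ i, r i • a i.castSucc) + (1 - ∑ i, r i) • a (Fin.last k)

/-- `w^i(t, r) = ∂/∂r_i x(t, h(r))`.  As `x(t, h(r))` is only given for `r` in the simplex, this is
the `i`-th partial derivative as read off from the (total) derivative relative to the simplex,
which is unique when it exists, as the simplex is convex with nonempty interior. -/
def variation {k n : ℕ} (x : ℝ → (Fin n → ℝ) → (Fin n → ℝ)) (a : Fin (k + 1) → Fin n → ℝ)
    (i : Fin k) (t : ℝ) (r : Fin k → ℝ) : Fin n → ℝ :=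
  fderivWithin ℝ (fun ρ => x t (convexComb a ρ)) (unitSimplex k) r (Pi.single i 1)

/-- `k`-order contraction on `Ω` of the system with solutions `x`, with respect to the norm `N`
and with rate `η`.  The derivatives that define the `w^i` are required to exist. -/
def IsKOrderContractiveWith (k : ℕ) {n : ℕ} (Ω : Set (Fin n → ℝ))
    (x : ℝ → (Fin n → ℝ) → (Fin n → ℝ)) (N : Seminorm ℝ ((Fin k ↪o Fin n) → ℝ)) (η : ℝ) : Prop :=
  ∀ a : Fin (k + 1) → Fin n → ℝ, (∀ i, a i ∈ Ω) → ∀ r ∈ unitSimplex k, ∀ t : ℝ, 0 ≤ t →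
    DifferentiableWithinAt ℝ (fun ρ => x t (convexComb a ρ)) (unitSimplex k) r ∧
    N (wedge fun i => variation x a i t r)
      ≤ Real.exp (-η * t) * N (wedge fun i => variation x a i 0 r)

/-- `k`-order contraction: there are a rate `η > 0` and a vector norm as above. -/
def IsKOrderContractive (k : ℕ) {n : ℕ} (Ω : Set (Fin n → ℝ))
    (x : ℝ → (Fin n → ℝ) → (Fin n → ℝ)) : Prop :=
  ∃ η : ℝ, 0 < η ∧ ∃ N : Seminorm ℝ ((Fin k ↪o Fin n) → ℝ), IsVectorNorm N ∧
    IsKOrderContractiveWith k Ω x N η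

end

end KContraction

namespace KContraction

/-! ### The Cauchy–Binet formula -/

/-! Along a trajectory in `Ω` the vectors `w^i` solve the variational equation `ẇ = J w`. By
Cauchy–Binet, `(I + εJ)v¹ ∧ ⋯ ∧ (I + εJ)vᵏ = (I + εJ)^(k) (v¹ ∧ ⋯ ∧ vᵏ)`. The derivative of this
identity at `ε = 0` shows that the wedge `W` of the `w^i` solves `Ẇ = J^[k] W`
(`hasDerivWithinAt_wedge`). The matrix measure bounds the upper right derivative of `N W` by
`μ(J^[k]) N W ≤ -η N W`, and Grönwall's inequality gives the exponential decay
(`IsVectorNorm.le_exp_mul`).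

It remains to see that the `w^i` exist and solve the variational equation. Solutions are given only
for initial points in `Ω`, so `x t` is differentiated relative to `Ω`. With `Φ` a fundamental
solution of the variational equation along the trajectory from `a`, a Grönwall comparison gives `x t
b - x t a - Φ t (b - a) = o(‖b - a‖)` for `b ∈ Ω` (`IsC1InState.exists_linearization`). Convexity
keeps `h(r)` in `Ω`, and the chain rule yields `w^i = Φ t (∂h/∂r_i)`. -/

theorem prod_mul_det_comp_perm {k n : ℕ} (X : Matrix (Fin k) (Fin n) ℝ)
    (Y : Matrix (Fin n) (Fin k) ℝ) (κ : Fin k ↪o Fin n) (σ : Equiv.Perm (Fin k)) :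
    (∏ i, X i (κ (σ i))) * (Y.submatrix (κ ∘ σ) id).det
      = (Equiv.Perm.sign σ : ℤ) * (∏ i, X i (κ (σ i))) * (Y.submatrix κ id).det := by
  have h : Y.submatrix (κ ∘ σ) id = (Y.submatrix κ id).submatrix σ id := rfl
  rw [h, Matrix.det_permute]
  ring

/-- Each row of `X * Y` is a combination of the rows of `Y`, and the determinant is multilinear in
the rows. -/
theorem det_mul_eq_sum_pi {k n : ℕ} (X : Matrix (Fin k) (Fin n) ℝ)
    (Y : Matrix (Fin n) (Fin k) ℝ) :
    (X * Y).det = ∑ p : Fin k → Fin n, (∏ i, X i (p i)) * (Y.submatrix p id).det := by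
  have h : X * Y = fun i => ∑ j, X i j • Y j := by
    ext i l
    simp [Matrix.mul_apply, Finset.sum_apply]
  rw [h]
  change Matrix.detRowAlternating (fun i => ∑ j, X i j • Y j) = _
  rw [← AlternatingMap.coe_multilinearMap, MultilinearMap.map_sum]
  refine Finset.sum_congr rfl fun p _ => ?_
  rw [MultilinearMap.map_smul_univ]
  rfl

theorem exists_orderEmb_comp_perm {k n : ℕ} {p : Fin k → Fin n} (hp : Function.Injective p) :
    ∃ (κ : Fin k ↪o Fin n) (σ : Equiv.Perm (Fin k)), κ ∘ σ = p := by
  have hs : StrictMono (p ∘ Tuple.sort p) :=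
    (Tuple.monotone_sort p).strictMono_of_injective (hp.comp (Tuple.sort p).injective)
  refine ⟨OrderEmbedding.ofStrictMono _ hs, (Tuple.sort p)⁻¹, ?_⟩
  ext i
  simp

/-- The range of the composite is that of `κ`, and an order embedding of `Fin k` is determined by
its range; then `σ` is determined as well. -/
theorem orderEmb_comp_perm_injective {k n : ℕ} :
    Function.Injective
      (fun q : (Fin k ↪o Fin n) × Equiv.Perm (Fin k) => (q.1 ∘ q.2 : Fin k → Fin n)) := by
  rintro ⟨κ, σ⟩ ⟨κ', σ'⟩ h
  have h' : (κ ∘ σ : Fin k → Fin n) = κ' ∘ σ' := h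
  have hr : Set.range κ = Set.range κ' := by
    rw [← σ.surjective.range_comp κ, ← σ'.surjective.range_comp κ', h']
  obtain rfl : κ = κ' := OrderEmbedding.range_inj.mp hr
  congr 1
  ext i
  exact congrArg Fin.val (κ.injective (congrFun h' i))

theorem det_mul_eq_sum_orderEmb {k n : ℕ} (X : Matrix (Fin k) (Fin n) ℝ)
    (Y : Matrix (Fin n) (Fin k) ℝ) :
    (X * Y).det = ∑ κ : Fin k ↪o Fin n, (X.submatrix id κ).det * (Y.submatrix κ id).det := by
  rw [det_mul_eq_sum_pi]
  have h : ∑ q : (Fin k ↪o Fin n) × Equiv.Perm (Fin k),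
      (∏ i, X i (q.1 (q.2 i))) * (Y.submatrix (q.1 ∘ q.2) id).det
      = ∑ p : Fin k → Fin n, (∏ i, X i (p i)) * (Y.submatrix p id).det := by
    refine Finset.sum_of_injOn _ orderEmb_comp_perm_injective.injOn
      (fun _ _ => by simp) (fun p _ hp => ?_) (fun _ _ => rfl)
    -- Sorting puts every injective `p` in the image of the pairs `(κ, σ)`; any other `p` repeats a
    -- row of `Y` and contributes zero.
    have hni : ¬ Function.Injective p := fun hi => hp <| by
      obtain ⟨κ, σ, h⟩ := exists_orderEmb_comp_perm hi
      exact ⟨(κ, σ), by simp, h⟩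
    simp only [Function.Injective, not_forall] at hni
    obtain ⟨i, j, hij, hne⟩ := hni
    rw [Matrix.det_zero_of_row_eq hne (by ext l; simp [hij]), mul_zero]
  rw [← h, Fintype.sum_prod_type]
  refine Finset.sum_congr rfl fun κ _ => ?_
  -- For fixed `κ` the signed products over `σ` add up to the minor of `X` with columns `κ`.
  simp_rw [prod_mul_det_comp_perm]
  rw [← Finset.sum_mul, ← Matrix.det_transpose (X.submatrix id κ),
    Matrix.det_apply' (X.submatrix id κ).transpose]
  rfl

/-! ### Compounds and wedge products -/

theorem wedge_mulVec {k n : ℕ} (A : Matrix (Fin n) (Fin n) ℝ) (v : Fin k → Fin n → ℝ) :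
    wedge (fun i => A.mulVec (v i)) = (multCompound k A).mulVec (wedge v) := by
  ext κ
  exact det_mul_eq_sum_orderEmb (A.submatrix κ id) (Matrix.of fun j i => v i j)

theorem differentiable_wedge {k n : ℕ} :
    Differentiable ℝ (wedge : (Fin k → Fin n → ℝ) → (Fin k ↪o Fin n) → ℝ) := by
  refine differentiable_pi.mpr fun κ => ?_
  simp only [wedge, multCompound, Matrix.det_apply', Matrix.submatrix_apply, Matrix.of_apply]
  fun_prop

theorem hasDerivAt_multCompound (k : ℕ) {n : ℕ} (A : Matrix (Fin n) (Fin n) ℝ)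
    (κ κ' : Fin k ↪o Fin n) :
    HasDerivAt (fun ε : ℝ => multCompound k (1 + ε • A) κ κ') (additiveCompound k A κ κ') 0 := by
  refine DifferentiableAt.hasDerivAt ?_
  simp only [multCompound, Matrix.det_apply', Matrix.submatrix_apply, Matrix.add_apply,
    Matrix.smul_apply]
  fun_prop

/-- The curve `ε ↦ wedge ((1 + ε • A) v)` is differentiated at `0` in two ways: by the chain rule,
and after `wedge_mulVec` has turned it into a compound matrix applied to a fixed vector. -/
theorem fderiv_wedge_mulVec {k n : ℕ} (A : Matrix (Fin n) (Fin n) ℝ) (v : Fin k → Fin n → ℝ) :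
    fderiv ℝ wedge v (fun i => A.mulVec (v i)) = (additiveCompound k A).mulVec (wedge v) := by
  have h1 : HasDerivAt (fun ε : ℝ => v + ε • fun i => A.mulVec (v i))
      (fun i => A.mulVec (v i)) 0 := by
    simpa using ((hasDerivAt_id (0 : ℝ)).smul_const (fun i => A.mulVec (v i))).const_add v
  have h2 : HasDerivAt (fun ε : ℝ => wedge (v + ε • fun i => A.mulVec (v i)))
      (fderiv ℝ wedge v (fun i => A.mulVec (v i))) 0 := by
    exact HasFDerivAt.comp_hasDerivAt_of_eq (0 : ℝ) (differentiable_wedge v).hasFDerivAt h1 (by simp)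
  have h3 : HasDerivAt (fun ε : ℝ => (multCompound k (1 + ε • A)).mulVec (wedge v))
      ((additiveCompound k A).mulVec (wedge v)) 0 := by
    refine hasDerivAt_pi.mpr fun κ => ?_
    simp only [Matrix.mulVec, dotProduct]
    exact HasDerivAt.fun_sum fun κ' _ => (hasDerivAt_multCompound k A κ κ').mul_const _
  refine h2.unique (h3.congr_of_eventuallyEq (Filter.Eventually.of_forall fun ε => ?_))
  simp only [← wedge_mulVec, Matrix.add_mulVec, Matrix.one_mulVec, Matrix.smul_mulVec]
  rfl

theorem hasDerivWithinAt_wedge {k n : ℕ} {v : ℝ → Fin k → Fin n → ℝ}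
    {A : Matrix (Fin n) (Fin n) ℝ} {s : Set ℝ} {t : ℝ}
    (hv : ∀ i, HasDerivWithinAt (fun τ => v τ i) (A.mulVec (v t i)) s t) :
    HasDerivWithinAt (fun τ => wedge (v τ)) ((additiveCompound k A).mulVec (wedge (v t))) s t := by
  rw [← fderiv_wedge_mulVec]
  exact (differentiable_wedge (v t)).hasFDerivAt.comp_hasDerivWithinAt t
    (hasDerivWithinAt_pi.mpr hv)

/-! ### Growth of a norm along a linear differential equation -/

theorem IsVectorNorm.mulVec_le {ι : Type*} [Fintype ι] {N : Seminorm ℝ (ι → ℝ)}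
    (hN : IsVectorNorm N) (A : Matrix ι ι ℝ) (v : ι → ℝ) :
    N (A.mulVec v) ≤ inducedNorm N A * N v := by
  by_cases h : N v = 0
  · rw [hN v h]
    simp
  have hpos : 0 < N v := lt_of_le_of_ne (apply_nonneg N v) (Ne.symm h)
  have h1 : N (A.mulVec ((N v)⁻¹ • v)) ≤ inducedNorm N A :=
    le_csSup (bddAbove_inducedNorm N hN A) ⟨_, by
      rw [map_smul_eq_mul, norm_inv, Real.norm_of_nonneg hpos.le, inv_mul_cancel₀ h], rfl⟩
  rw [Matrix.mulVec_smul, map_smul_eq_mul, norm_inv, Real.norm_of_nonneg hpos.le,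
    inv_mul_eq_div, div_le_iff₀ hpos] at h1
  exact h1

theorem continuous_seminorm_pi {ι : Type*} [Fintype ι] (N : Seminorm ℝ (ι → ℝ)) :
    Continuous N := by
  classical
  refine Seminorm.continuous_of_le (q := (∑ i, N (Pi.single i 1)).toNNReal • normSeminorm ℝ (ι → ℝ))
    ?_ ?_
  · exact continuous_const.mul continuous_norm
  · intro v
    have hv : v = ∑ i, v i • (Pi.single i 1 : ι → ℝ) := by
      ext j
      simp [Finset.sum_apply, Pi.single_apply]
    calc N v = N (∑ i, v i • (Pi.single i 1 : ι → ℝ)) := by rw [← hv]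
      _ ≤ ∑ i, N (v i • (Pi.single i 1 : ι → ℝ)) := Finset.le_sum_of_subadditive N (map_zero N).le (map_add_le_add N) _ _
      _ ≤ ∑ i, ‖v‖ * N (Pi.single i 1) := by
          refine Finset.sum_le_sum fun i _ => ?_
          rw [map_smul_eq_mul]
          exact mul_le_mul_of_nonneg_right (norm_le_pi_norm v i) (apply_nonneg N _)
      _ = (∑ i, N (Pi.single i 1)) * ‖v‖ := by rw [← Finset.mul_sum, mul_comm]
      _ = ((∑ i, N (Pi.single i 1)).toNNReal • normSeminorm ℝ (ι → ℝ)) v := by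
          rw [smul_apply, NNReal.smul_def,
            Real.coe_toNNReal _ (Finset.sum_nonneg fun i _ => apply_nonneg N _)]
          rfl

/-- From `W z = (1 + (z - t) B) W t + o(z - t)`, the difference quotient of `N ∘ W` is at most `(‖1
+ (z - t) B‖ - 1) / (z - t) * N (W t) + o(1)`. The conclusion has the form that the liminf version
of Grönwall's inequality takes. -/
theorem IsVectorNorm.frequently_slope_lt {ι : Type*} [Fintype ι] [DecidableEq ι] [Nonempty ι]
    {N : Seminorm ℝ (ι → ℝ)} (hN : IsVectorNorm N) {B : Matrix ι ι ℝ} {W : ℝ → ι → ℝ} {t r : ℝ}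
    (hW : HasDerivWithinAt W (B.mulVec (W t)) (Set.Ici t) t) (hr : matrixMeasure N B * N (W t) < r) :
    ∃ᶠ z in nhdsWithin t (Set.Ioi t), (z - t)⁻¹ * (N (W z) - N (W t)) < r := by
  refine Filter.Eventually.frequently ?_
  have hs : Filter.Tendsto (fun z : ℝ => z - t) (nhdsWithin t (Set.Ioi t))
      (nhdsWithin 0 (Set.Ioi 0)) := by
    refine tendsto_nhdsWithin_iff.mpr ⟨?_, ?_⟩
    · refine ((continuous_id.sub continuous_const).tendsto' t 0 ?_).mono_left nhdsWithin_le_nhds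
      simp
    · filter_upwards [self_mem_nhdsWithin] with z hz
      exact Set.mem_Ioi.mpr (sub_pos.mpr (Set.mem_Ioi.mp hz))
  have h1 := ((tendsto_matrixMeasure N hN B).comp hs).mul_const (N (W t))
  have h2 : Filter.Tendsto (fun z => N (slope W t z - B.mulVec (W t)))
      (nhdsWithin t (Set.Ioi t)) (nhds 0) := by
    have h := (hW.mono Set.Ioi_subset_Ici_self)
    rw [hasDerivWithinAt_iff_tendsto_slope' (by simp)] at h
    have h' := ((continuous_seminorm_pi N).tendsto _).comp (h.sub_const (B.mulVec (W t)))
    simpa [Function.comp_def] using h'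
  have h3 := h1.add h2
  rw [add_zero] at h3
  filter_upwards [h3.eventually_lt_const hr, self_mem_nhdsWithin] with z hz hzt
  have hpos : 0 < z - t := sub_pos.mpr hzt
  refine lt_of_le_of_lt ?_ hz
  have hsplit : W z = (1 + (z - t) • B).mulVec (W t)
      + (z - t) • (slope W t z - B.mulVec (W t)) := by
    rw [Matrix.add_mulVec, Matrix.one_mulVec, Matrix.smul_mulVec, smul_sub, sub_smul_slope,
      vsub_eq_sub]
    abel
  have h4 : N (W z) ≤ inducedNorm N (1 + (z - t) • B) * N (W t)
      + (z - t) * N (slope W t z - B.mulVec (W t)) := by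
    conv_lhs => rw [hsplit]
    refine (map_add_le_add N _ _).trans (add_le_add (hN.mulVec_le _ _) ?_)
    rw [map_smul_eq_mul, Real.norm_of_nonneg hpos.le]
  simp only [Function.comp_apply]
  rw [inv_mul_le_iff₀ hpos, mul_add, ← mul_assoc, mul_div_cancel₀ _ hpos.ne']
  linarith

/-- Grönwall's inequality for `N ∘ W`, with a rate `c` of any sign. Beyond the differential equation
itself, `B` enters only through the bound on its measure, so no regularity in time is asked of it.
-/
theorem IsVectorNorm.le_exp_mul {ι : Type*} [Fintype ι] [DecidableEq ι] [Nonempty ι]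
    {N : Seminorm ℝ (ι → ℝ)} (hN : IsVectorNorm N) {B : ℝ → Matrix ι ι ℝ} {W : ℝ → ι → ℝ}
    {T c : ℝ} (hc : ContinuousOn W (Set.Icc 0 T))
    (hW : ∀ t ∈ Set.Ico 0 T, HasDerivWithinAt W ((B t).mulVec (W t)) (Set.Ici t) t)
    (hB : ∀ t ∈ Set.Ico 0 T, matrixMeasure N (B t) ≤ c) :
    ∀ t ∈ Set.Icc 0 T, N (W t) ≤ Real.exp (c * t) * N (W 0) := by
  intro t ht
  have h := le_gronwallBound_of_liminf_deriv_right_le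
    (f := fun t => N (W t)) (f' := fun t => matrixMeasure N (B t) * N (W t)) (K := c) (ε := 0)
    ((continuous_seminorm_pi N).comp_continuousOn hc)
    (fun t ht r hr => hN.frequently_slope_lt (hW t ht) hr) le_rfl
    (fun t ht => by
      rw [add_zero]
      exact mul_le_mul_of_nonneg_right (hB t ht) (apply_nonneg N _)) t ht
  rw [gronwallBound_ε0, sub_zero, mul_comm] at h
  exact h

/-! ### Linear differential equations -/

theorem hasDerivWithinAt_Ici_of_Icc {E : Type*} [NormedAddCommGroup E] [NormedSpace ℝ E]
    {w : ℝ → E} {w' : E} {T t : ℝ} (ht : t ∈ Set.Ico 0 T)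
    (hw : HasDerivWithinAt w w' (Set.Icc 0 T) t) : HasDerivWithinAt w w' (Set.Ici t) t :=
  hw.mono_of_mem_nhdsWithin (Icc_mem_nhdsGE_of_mem ht)

/-- Coordinatewise truncation of a vector to the cube `[-R, R]^n`. -/
def clamp {n : ℕ} (R : ℝ) (v : Fin n → ℝ) : Fin n → ℝ := fun i => max (-R) (min R (v i))

theorem lipschitzWith_clamp {n : ℕ} (R : ℝ) :
    LipschitzWith 1 (clamp R : (Fin n → ℝ) → Fin n → ℝ) := by
  refine LipschitzWith.of_dist_le_mul fun v w => ?_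
  rw [NNReal.coe_one, one_mul]
  refine (dist_pi_le_iff dist_nonneg).mpr fun i => ?_
  have h := (((LipschitzWith.id (α := ℝ)).const_min R).const_max (-R)).dist_le_mul (v i) (w i)
  rw [NNReal.coe_one, one_mul] at h
  exact h.trans (dist_le_pi_dist v w i)

theorem norm_clamp_le {n : ℕ} {R : ℝ} (hR : 0 ≤ R) (v : Fin n → ℝ) : ‖clamp R v‖ ≤ R :=
  (pi_norm_le_iff_of_nonneg hR).mpr fun i =>
    abs_le.mpr ⟨le_max_left _ _, max_le (by linarith) (min_le_left _ _)⟩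

theorem clamp_eq_self {n : ℕ} {R : ℝ} {v : Fin n → ℝ} (hv : ‖v‖ ≤ R) : clamp R v = v := by
  ext i
  have h := abs_le.mp ((norm_le_pi_norm v i).trans hv)
  rw [clamp, min_eq_right h.2, max_eq_right h.1]

theorem norm_clamp_le_norm {n : ℕ} {R : ℝ} (hR : 0 ≤ R) (v : Fin n → ℝ) :
    ‖clamp R v‖ ≤ ‖v‖ := by
  have h := (lipschitzWith_clamp R).dist_le_mul v 0
  rwa [clamp_eq_self (v := 0) (by simpa using hR), NNReal.coe_one, one_mul, dist_zero_right,
    dist_zero_right] at h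

/-- An untruncated linear field grows with the solution, which limits the time span of
Picard–Lindelöf. Truncation at the a priori bound `R = ‖v‖ exp(K T)` makes the field bounded, so one
application covers `[0, T]`; Grönwall then shows that the truncation never acts on the solution. -/
theorem exists_linear_solution {n : ℕ} {T : ℝ} (hT : 0 ≤ T)
    {A : ℝ → (Fin n → ℝ) →L[ℝ] (Fin n → ℝ)} (hA : ContinuousOn A (Set.Icc 0 T))
    (v : Fin n → ℝ) :
    ∃ w : ℝ → Fin n → ℝ, w 0 = v ∧ IsIntegralCurveOn w (fun t => A t) (Set.Icc 0 T) := by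
  obtain ⟨K₀, hK₀⟩ := isCompact_Icc.exists_bound_of_continuousOn hA
  have hK0 : 0 ≤ K₀ := (norm_nonneg _).trans (hK₀ 0 ⟨le_rfl, hT⟩)
  lift K₀ to NNReal using hK0 with K
  have hR0 : 0 ≤ ‖v‖ * Real.exp (K * T) := by positivity
  obtain ⟨R, hR⟩ : ∃ R : NNReal, (R : ℝ) = ‖v‖ * Real.exp (K * T) := ⟨⟨_, hR0⟩, rfl⟩
  -- The speed is at most `K * R`, so a ball of radius `K * R * T` is not left within time `T`.
  have hpl : IsPicardLindelof (fun t u => A t (clamp R u)) (tmin := 0) (tmax := T)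
      ⟨0, le_rfl, hT⟩ v (K * R * T.toNNReal) 0 (K * R) K :=
    { lipschitzOnWith := fun t ht => by
        have h := ((A t).lipschitz.comp (lipschitzWith_clamp (n := n) R)).weaken
          (K := ‖A t‖₊ * 1) (K' := K) (by rw [mul_one]; exact hK₀ t ht)
        exact h.lipschitzOnWith
      continuousOn := fun u _ => hA.clm_apply continuousOn_const
      norm_le := fun t ht u _ => by
        rw [NNReal.coe_mul]
        exact (A t).le_of_opNorm_le_of_le (hK₀ t ht) (norm_clamp_le R.coe_nonneg u)
      mul_max_le := by simp [hT] }
  obtain ⟨w, hw0, hw⟩ := hpl.exists_eq_forall_mem_Icc_hasDerivWithinAt₀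
  have hb := norm_le_gronwallBound_of_norm_deriv_right_le (δ := ‖v‖) (K := K) (ε := 0)
    (fun t ht => (hw t ht).continuousWithinAt)
    (fun t ht => hasDerivWithinAt_Ici_of_Icc ht (hw t (Set.Ico_subset_Icc_self ht)))
    (by rw [← hw0]) (fun t ht => by
      rw [add_zero]
      exact (A t).le_of_opNorm_le_of_le (hK₀ t (Set.Ico_subset_Icc_self ht))
        (norm_clamp_le_norm R.coe_nonneg (w t)))
  refine ⟨w, hw0, fun t ht => ?_⟩
  have hwt : ‖w t‖ ≤ R := by
    refine (hb t ht).trans ?_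
    rw [gronwallBound_ε0, sub_zero, hR]
    have := ht.2
    gcongr
  have h := hw t ht
  rwa [clamp_eq_self hwt] at h

/-- Existence of a fundamental solution of a linear differential equation. -/
theorem exists_fundamental_solution {n : ℕ} {T : ℝ} (hT : 0 ≤ T)
    {A : ℝ → (Fin n → ℝ) →L[ℝ] (Fin n → ℝ)} (hA : ContinuousOn A (Set.Icc 0 T)) :
    ∃ Φ : ℝ → (Fin n → ℝ) →L[ℝ] (Fin n → ℝ), (∀ v, Φ 0 v = v) ∧
      ∀ v, IsIntegralCurveOn (fun t => Φ t v) (fun t => A t) (Set.Icc 0 T) := by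
  -- `Φ t` is the linear map that sends the basis vector `e_i` to the solution starting from `e_i`.
  choose w hw0 hw using fun i : Fin n => exists_linear_solution hT hA (Pi.single i 1)
  refine ⟨fun t => ∑ i, (ContinuousLinearMap.proj i : (Fin n → ℝ) →L[ℝ] ℝ).smulRight (w i t),
    fun v => ?_, fun v t ht => ?_⟩
  · ext j
    simp [hw0, Finset.sum_apply, Pi.single_apply]
  · simp only [sum_apply, ContinuousLinearMap.smulRight_apply,
      ContinuousLinearMap.proj_apply, map_sum, map_smul]
    exact HasDerivWithinAt.fun_sum fun i _ => (hw i t ht).const_smul (v i)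

/-! ### Dependence of solutions on the initial condition -/

theorem IsC1InState.continuousOn_fderiv {n : ℕ} {f : ℝ → (Fin n → ℝ) → (Fin n → ℝ)}
    (hf : IsC1InState f) {γ : ℝ → Fin n → ℝ} {T : ℝ} (hγ : ContinuousOn γ (Set.Icc 0 T)) :
    ContinuousOn (fun t => fderiv ℝ (f t) (γ t)) (Set.Icc 0 T) :=
  hf.2.comp (continuousOn_id.prodMk hγ) fun _ ht => ⟨ht.1, Set.mem_univ _⟩

/-- A first order Taylor estimate along a curve, uniform in time. -/
theorem IsC1InState.exists_taylor_along {n : ℕ} {f : ℝ → (Fin n → ℝ) → (Fin n → ℝ)}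
    (hf : IsC1InState f) {γ : ℝ → Fin n → ℝ} {T : ℝ} (hγ : ContinuousOn γ (Set.Icc 0 T))
    {ε : ℝ} (hε : 0 < ε) :
    ∃ δ > 0, ∀ t ∈ Set.Icc 0 T, ∀ y, ‖y - γ t‖ ≤ δ →
      ‖f t y - f t (γ t) - fderiv ℝ (f t) (γ t) (y - γ t)‖ ≤ ε * ‖y - γ t‖ := by
  -- In terms of displacement from `γ`, the tube of radius `1` about the curve is a compact product,
  -- so the derivative is uniformly continuous on it.
  have hc : ContinuousOn (fun p : ℝ × (Fin n → ℝ) => fderiv ℝ (f p.1) (γ p.1 + p.2))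
      (Set.Icc 0 T ×ˢ Metric.closedBall 0 1) := by
    refine hf.2.comp (f := fun p : ℝ × (Fin n → ℝ) => (p.1, γ p.1 + p.2))
      (continuousOn_fst.prodMk ((hγ.comp continuousOn_fst fun p hp => hp.1).add continuousOn_snd))
      fun p hp => ⟨hp.1.1, Set.mem_univ _⟩
  have hu := (isCompact_Icc.prod (isCompact_closedBall _ _)).uniformContinuousOn_of_continuous hc
  obtain ⟨δ, hδ, h⟩ := Metric.uniformContinuousOn_iff_le.mp hu ε hε
  refine ⟨min δ 1, by positivity, fun t ht y hy => ?_⟩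
  have hmem : y ∈ Metric.closedBall (γ t) (min δ 1) := by rwa [mem_closedBall_iff_norm]
  refine Convex.norm_image_sub_le_of_norm_fderiv_le' (s := Metric.closedBall (γ t) (min δ 1))
    (fun z _ => hf.1 t ht.1 z) (fun z hz => ?_) (convex_closedBall _ _)
    (Metric.mem_closedBall_self (by positivity)) hmem
  rw [mem_closedBall_iff_norm] at hz
  have hz' := h (t, z - γ t) ⟨ht, by simpa using hz.trans (min_le_right _ _)⟩
    (t, 0) ⟨ht, by simp⟩ (by simpa [Prod.dist_eq] using hz.trans (min_le_left _ _))
  simpa [dist_eq_norm] using hz'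

/-- Solutions that start close to a given solution stay close to it. -/
theorem IsC1InState.exists_lipschitz_initial {n : ℕ} {f : ℝ → (Fin n → ℝ) → (Fin n → ℝ)}
    (hf : IsC1InState f) {γ : ℝ → Fin n → ℝ} {T : ℝ} (hT : 0 ≤ T)
    (hγ : IsIntegralCurveOn γ f (Set.Icc 0 T)) :
    ∃ C > 0, ∃ δ > 0, ∀ β : ℝ → Fin n → ℝ, IsIntegralCurveOn β f (Set.Icc 0 T) →
      ‖β 0 - γ 0‖ ≤ δ → ∀ t ∈ Set.Icc 0 T, ‖β t - γ t‖ ≤ C * ‖β 0 - γ 0‖ := by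
  have hγc : ContinuousOn γ (Set.Icc 0 T) := fun t ht => (hγ t ht).continuousWithinAt
  obtain ⟨K, hK⟩ := isCompact_Icc.exists_bound_of_continuousOn (hf.continuousOn_fderiv hγc)
  have hK0 : 0 ≤ K := (norm_nonneg _).trans (hK 0 ⟨le_rfl, hT⟩)
  obtain ⟨ρ, hρ, htaylor⟩ := hf.exists_taylor_along hγc one_pos
  have hlip : ∀ t ∈ Set.Icc 0 T, ∀ y, ‖y - γ t‖ ≤ ρ →
      ‖f t y - f t (γ t)‖ ≤ (K + 1) * ‖y - γ t‖ := fun t ht y hy => by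
    have h1 := htaylor t ht y hy
    have h2 := (fderiv ℝ (f t) (γ t)).le_of_opNorm_le (hK t ht) (y - γ t)
    have h3 := norm_sub_norm_le (f t y - f t (γ t)) (fderiv ℝ (f t) (γ t) (y - γ t))
    linarith
  -- The Lipschitz bound `hlip` holds only in the tube of radius `ρ`. The barrier `ρ * exp((K + 2)(t
  -- - T))` reaches `ρ` at time `T`, and its growth rate `K + 2` strictly exceeds `K + 1`, so a
  -- difference that starts below it cannot cross it. Grönwall can then be applied on all of `[0,
  -- T]`.
  refine ⟨Real.exp ((K + 1) * T), Real.exp_pos _, ρ * Real.exp ((K + 2) * (0 - T)), by positivity,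
    fun β hβ h0 => ?_⟩
  have hcont : ContinuousOn (fun t => β t - γ t) (Set.Icc 0 T) :=
    fun t ht => (hβ t ht).continuousWithinAt.sub (hγ t ht).continuousWithinAt
  have hder : ∀ t ∈ Set.Ico 0 T,
      HasDerivWithinAt (fun t => β t - γ t) (f t (β t) - f t (γ t)) (Set.Ici t) t := fun t ht =>
    hasDerivWithinAt_Ici_of_Icc ht
      ((hβ t (Set.Ico_subset_Icc_self ht)).sub (hγ t (Set.Ico_subset_Icc_self ht)))
  have htube_le : ∀ t ∈ Set.Icc 0 T, ρ * Real.exp ((K + 2) * (t - T)) ≤ ρ := fun t ht => by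
    refine mul_le_of_le_one_right hρ.le (Real.exp_le_one_iff.mpr ?_)
    exact mul_nonpos_of_nonneg_of_nonpos (by linarith) (by linarith [ht.2])
  have htube : ∀ t ∈ Set.Icc 0 T, ‖β t - γ t‖ ≤ ρ * Real.exp ((K + 2) * (t - T)) := by
    refine fun t ht => image_norm_le_of_norm_deriv_right_lt_deriv_boundary hcont hder
      (B := fun t => ρ * Real.exp ((K + 2) * (t - T)))
      (B' := fun t => ρ * (Real.exp ((K + 2) * (t - T)) * (K + 2))) h0 (fun t => ?_)
      (fun t ht h => ?_) ht
    · have := ((((hasDerivAt_id t).sub_const T).const_mul (K + 2)).exp).const_mul ρ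
      simpa using this
    · have ht' := Set.Ico_subset_Icc_self ht
      refine (hlip t ht' (β t) (h.le.trans (htube_le t ht'))).trans_lt ?_
      rw [h]
      have : 0 < ρ * Real.exp ((K + 2) * (t - T)) := by positivity
      linarith
  intro t ht
  have h := norm_le_gronwallBound_of_norm_deriv_right_le (K := K + 1) (ε := 0) hcont hder le_rfl
    (fun t ht => by
      have ht' := Set.Ico_subset_Icc_self ht
      rw [add_zero]
      exact hlip t ht' (β t) ((htube t ht').trans (htube_le t ht'))) t ht
  rw [gronwallBound_ε0, sub_zero, mul_comm] at h
  refine h.trans ?_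
  have := ht.2
  gcongr

/-- Solutions of the variational equation approximate differences of solutions to first order. -/
theorem IsC1InState.exists_linearization {n : ℕ} {f : ℝ → (Fin n → ℝ) → (Fin n → ℝ)}
    (hf : IsC1InState f) {γ : ℝ → Fin n → ℝ} {T : ℝ} (hT : 0 ≤ T)
    (hγ : IsIntegralCurveOn γ f (Set.Icc 0 T)) {ε : ℝ} (hε : 0 < ε) :
    ∃ δ > 0, ∀ β w : ℝ → Fin n → ℝ, IsIntegralCurveOn β f (Set.Icc 0 T) →
      IsIntegralCurveOn w (fun t => fderiv ℝ (f t) (γ t)) (Set.Icc 0 T) → w 0 = β 0 - γ 0 →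
      ‖β 0 - γ 0‖ ≤ δ → ∀ t ∈ Set.Icc 0 T, ‖β t - γ t - w t‖ ≤ ε * ‖β 0 - γ 0‖ := by
  have hγc : ContinuousOn γ (Set.Icc 0 T) := fun t ht => (hγ t ht).continuousWithinAt
  obtain ⟨K₀, hK₀⟩ := isCompact_Icc.exists_bound_of_continuousOn (hf.continuousOn_fderiv hγc)
  -- The bound is made positive because the Grönwall bound with a source term divides by `K`.
  obtain ⟨K, hKpos, hK⟩ : ∃ K > 0, ∀ t ∈ Set.Icc 0 T, ‖fderiv ℝ (f t) (γ t)‖ ≤ K :=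
    ⟨max K₀ 1, by positivity, fun t ht => (hK₀ t ht).trans (le_max_left _ _)⟩
  obtain ⟨C, hC, δ, hδ, hlip⟩ := hf.exists_lipschitz_initial hT hγ
  -- The tolerance absorbs the factor `C` from `‖β t - γ t‖ ≤ C * ‖β 0 - γ 0‖` and the Grönwall
  -- factor `(exp(K t) - 1) / K ≤ exp(K T) / K`.
  obtain ⟨ρ, hρ, htaylor⟩ := hf.exists_taylor_along hγc
    (ε := ε * K / (C * Real.exp (K * T))) (by positivity)
  refine ⟨min δ (ρ / C), by positivity, fun β w hβ hw hw0 h0 t ht => ?_⟩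
  have hclose := hlip β hβ (h0.trans (min_le_left _ _))
  have h := norm_le_gronwallBound_of_norm_deriv_right_le (δ := 0) (K := K)
    (ε := ε * K / Real.exp (K * T) * ‖β 0 - γ 0‖) (f := fun t => β t - γ t - w t)
    (f' := fun t => f t (β t) - f t (γ t) - fderiv ℝ (f t) (γ t) (w t))
    (fun t ht => ((hβ t ht).continuousWithinAt.sub (hγ t ht).continuousWithinAt).sub
      (hw t ht).continuousWithinAt)
    (fun t ht => hasDerivWithinAt_Ici_of_Icc ht
      (((hβ t (Set.Ico_subset_Icc_self ht)).sub (hγ t (Set.Ico_subset_Icc_self ht))).sub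
        (hw t (Set.Ico_subset_Icc_self ht))))
    (by simp [hw0]) (fun t ht => ?_) t ht
  · refine h.trans ?_
    rw [gronwallBound_of_K_ne_0 hKpos.ne', sub_zero]
    have hexp : Real.exp (K * t) - 1 ≤ Real.exp (K * T) := by
      have : Real.exp (K * t) ≤ Real.exp (K * T) := by
        have := ht.2
        gcongr
      linarith
    calc 0 * Real.exp (K * t)
          + ε * K / Real.exp (K * T) * ‖β 0 - γ 0‖ / K * (Real.exp (K * t) - 1)
        ≤ 0 * Real.exp (K * t)
          + ε * K / Real.exp (K * T) * ‖β 0 - γ 0‖ / K * Real.exp (K * T) := by gcongr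
      _ = ε * ‖β 0 - γ 0‖ := by field_simp; ring
  · have ht' := Set.Ico_subset_Icc_self ht
    have hb := hclose t ht'
    have hsmall : ‖β t - γ t‖ ≤ ρ := by
      refine hb.trans ?_
      have := h0.trans (min_le_right _ _)
      rwa [le_div_iff₀' hC] at this
    have h1 := htaylor t ht' (β t) hsmall
    have h2 := (fderiv ℝ (f t) (γ t)).le_of_opNorm_le (hK t ht') (β t - γ t - w t)
    -- The error obeys the linear equation up to the Taylor remainder, which acts as the source
    -- term.
    have hsplit : f t (β t) - f t (γ t) - fderiv ℝ (f t) (γ t) (w t)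
        = fderiv ℝ (f t) (γ t) (β t - γ t - w t)
          + (f t (β t) - f t (γ t) - fderiv ℝ (f t) (γ t) (β t - γ t)) := by
      rw [map_sub _ (β t - γ t) (w t)]
      abel
    rw [hsplit]
    refine (norm_add_le _ _).trans (add_le_add h2 (h1.trans ?_))
    calc ε * K / (C * Real.exp (K * T)) * ‖β t - γ t‖
        ≤ ε * K / (C * Real.exp (K * T)) * (C * ‖β 0 - γ 0‖) := by gcongr
      _ = ε * K / Real.exp (K * T) * ‖β 0 - γ 0‖ := by field_simp

/-- The solution map is differentiable relative to `Ω`, with derivative the fundamental solution of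
the variational equation. -/
theorem IsSolutionMap.hasFDerivWithinAt {n : ℕ} {f : ℝ → (Fin n → ℝ) → (Fin n → ℝ)}
    {Ω : Set (Fin n → ℝ)} {x : ℝ → (Fin n → ℝ) → (Fin n → ℝ)} (hx : IsSolutionMap f Ω x)
    (hf : IsC1InState f) {a : Fin n → ℝ} (ha : a ∈ Ω) {T : ℝ} (hT : 0 ≤ T)
    {Φ : ℝ → (Fin n → ℝ) →L[ℝ] (Fin n → ℝ)} (hΦ0 : ∀ v, Φ 0 v = v)
    (hΦ : ∀ v, IsIntegralCurveOn (fun t => Φ t v) (fun t => fderiv ℝ (f t) (x t a))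
      (Set.Icc 0 T)) {t : ℝ} (ht : t ∈ Set.Icc 0 T) :
    HasFDerivWithinAt (x t) (Φ t) Ω a := by
  have hcurve : ∀ b ∈ Ω, IsIntegralCurveOn (fun t => x t b) f (Set.Icc 0 T) :=
    fun b hb t ht => ((hx b hb).2.1 t ht.1).mono Set.Icc_subset_Ici_self
  refine HasFDerivWithinAt.of_isLittleO (Asymptotics.isLittleO_iff.mpr fun ε hε => ?_)
  obtain ⟨δ, hδ, h⟩ := hf.exists_linearization hT (hcurve a ha) hε
  filter_upwards [self_mem_nhdsWithin, nhdsWithin_le_nhds (Metric.closedBall_mem_nhds a hδ)]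
    with b hb hba
  have h' := h (fun t => x t b) (fun t => Φ t (b - a)) (hcurve b hb) (hΦ (b - a))
    (by simp only [hΦ0, (hx b hb).1, (hx a ha).1])
    (by simpa only [(hx b hb).1, (hx a ha).1, mem_closedBall_iff_norm] using hba) t ht
  simpa only [(hx b hb).1, (hx a ha).1] using h'

/-! ### The simplex -/

/-- Lets `fderivWithin` in `variation` be identified with any derivative found relative to the
simplex, also at boundary points. -/
theorem uniqueDiffOn_unitSimplex (k : ℕ) : UniqueDiffOn ℝ (unitSimplex k) := by
  refine uniqueDiffOn_convex ?_ ?_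
  · intro r hr s hs a b ha hb hab
    refine ⟨fun i => add_nonneg (mul_nonneg ha (hr.1 i)) (mul_nonneg hb (hs.1 i)), ?_⟩
    simp only [Pi.add_apply, Pi.smul_apply, smul_eq_mul, Finset.sum_add_distrib, ← Finset.mul_sum]
    have := mul_le_mul_of_nonneg_left hr.2 ha
    have := mul_le_mul_of_nonneg_left hs.2 hb
    linarith
  -- The barycentre is an interior point.
  · refine ⟨fun _ => 1 / ((k : ℝ) + 1), mem_interior.mpr
      ⟨(⋂ i, {r : Fin k → ℝ | 0 < r i}) ∩ {r | ∑ i, r i < 1},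
        fun r hr => ⟨fun i => (Set.mem_iInter.mp hr.1 i).le, hr.2.le⟩, ?_,
        Set.mem_iInter.mpr fun i => ?_, ?_⟩⟩
    · exact (isOpen_iInter_of_finite fun i =>
        isOpen_lt continuous_const (continuous_apply i)).inter
        (isOpen_lt (f := fun r : Fin k → ℝ => ∑ i, r i) (by fun_prop) continuous_const)
    · exact Nat.one_div_pos_of_nat (α := ℝ)
    · change ∑ _ : Fin k, 1 / ((k : ℝ) + 1) < 1
      rw [Finset.sum_const, Finset.card_univ, Fintype.card_fin, nsmul_eq_mul, mul_one_div,
        div_lt_one (by positivity)]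
      linarith

theorem convexComb_mem {k n : ℕ} {Ω : Set (Fin n → ℝ)} (hΩ : Convex ℝ Ω)
    {a : Fin (k + 1) → Fin n → ℝ} (ha : ∀ i, a i ∈ Ω) {r : Fin k → ℝ} (hr : r ∈ unitSimplex k) :
    convexComb a r ∈ Ω := by
  have h := hΩ.sum_mem (t := Finset.univ) (w := Fin.snoc (α := fun _ => ℝ) r (1 - ∑ i, r i))
    (z := a) ?_ ?_ (fun i _ => ha i)
  · simpa [Fin.sum_univ_castSucc, convexComb] using h
  · intro i _
    refine Fin.lastCases ?_ (fun j => ?_) i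
    · simpa using hr.2
    · simpa using hr.1 j
  · simp [Fin.sum_univ_castSucc]

theorem differentiable_convexComb {k n : ℕ} (a : Fin (k + 1) → Fin n → ℝ) :
    Differentiable ℝ (convexComb a) := by
  unfold convexComb
  fun_prop

/-! ### `k`-order contraction -/

theorem jacobian_mulVec {n : ℕ} (f : ℝ → (Fin n → ℝ) → (Fin n → ℝ)) (t : ℝ) (x v : Fin n → ℝ) :
    (jacobian f t x).mulVec v = fderiv ℝ (f t) x v :=
  LinearMap.toMatrix'_mulVec _ _

/-- The partial derivatives of `r ↦ x(t, h(r))` solve the variational equation. -/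
theorem IsSolutionMap.differentiableWithinAt_and_variation {k n : ℕ}
    {f : ℝ → (Fin n → ℝ) → (Fin n → ℝ)} {Ω : Set (Fin n → ℝ)} (hΩ : Convex ℝ Ω)
    {x : ℝ → (Fin n → ℝ) → (Fin n → ℝ)} (hx : IsSolutionMap f Ω x) (hf : IsC1InState f)
    {a : Fin (k + 1) → Fin n → ℝ} (ha : ∀ i, a i ∈ Ω) {r : Fin k → ℝ} (hr : r ∈ unitSimplex k)
    {T : ℝ} (hT : 0 ≤ T) :
    (∀ t ∈ Set.Icc 0 T,
      DifferentiableWithinAt ℝ (fun ρ => x t (convexComb a ρ)) (unitSimplex k) r) ∧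
    ∀ i, IsIntegralCurveOn (fun t => variation x a i t r)
      (fun t => (jacobian f t (x t (convexComb a r))).mulVec) (Set.Icc 0 T) := by
  have hmem := convexComb_mem hΩ ha hr
  have hγc : ContinuousOn (fun t => x t (convexComb a r)) (Set.Icc 0 T) := fun t ht =>
    (((hx _ hmem).2.1 t ht.1).mono Set.Icc_subset_Ici_self).continuousWithinAt
  obtain ⟨Φ, hΦ0, hΦ⟩ := exists_fundamental_solution hT (hf.continuousOn_fderiv hγc)
  obtain ⟨D, hD⟩ := differentiable_convexComb a r
  have hder : ∀ t ∈ Set.Icc 0 T, HasFDerivWithinAt (fun ρ => x t (convexComb a ρ))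
      ((Φ t).comp D) (unitSimplex k) r := fun t ht =>
    (hx.hasFDerivWithinAt hf hmem hT hΦ0 hΦ ht).comp r hD.hasFDerivWithinAt
      fun ρ hρ => convexComb_mem hΩ ha hρ
  have hvar : ∀ i, ∀ t ∈ Set.Icc 0 T, variation x a i t r = Φ t (D (Pi.single i 1)) :=
    fun i t ht => by
      rw [variation, (hder t ht).fderivWithin (uniqueDiffOn_unitSimplex k r hr)]
      rfl
  refine ⟨fun t ht => (hder t ht).differentiableWithinAt, fun i t ht => ?_⟩
  refine HasDerivWithinAt.congr_of_mem ?_ (hvar i) ht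
  beta_reduce
  rw [jacobian_mulVec, hvar i t ht]
  exact hΦ _ t ht

theorem IsSolutionMap.isKOrderContractiveWith {n k : ℕ} (hkn : k ≤ n)
    {f : ℝ → (Fin n → ℝ) → (Fin n → ℝ)} {Ω : Set (Fin n → ℝ)} (hΩ : Convex ℝ Ω)
    (hf : IsC1InState f) {x : ℝ → (Fin n → ℝ) → (Fin n → ℝ)} (hx : IsSolutionMap f Ω x) {η : ℝ}
    {N : Seminorm ℝ ((Fin k ↪o Fin n) → ℝ)} (hN : IsVectorNorm N)
    (hμ : ∀ t : ℝ, 0 ≤ t → ∀ a ∈ Ω,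
      matrixMeasure N (additiveCompound k (jacobian f t a)) ≤ -η) :
    IsKOrderContractiveWith k Ω x N η := by
  intro a ha r hr t ht
  obtain ⟨hdiff, hvar⟩ := hx.differentiableWithinAt_and_variation hΩ hf ha hr ht
  refine ⟨hdiff t ⟨ht, le_rfl⟩, ?_⟩
  -- `k ≤ n` makes the compound space nonzero, so vectors of norm one exist and the limit defining
  -- the measure does too.
  have : Nonempty (Fin k ↪o Fin n) := ⟨Fin.castLEOrderEmb hkn⟩
  have hmem := convexComb_mem hΩ ha hr
  have hW : ∀ s ∈ Set.Icc 0 t, HasDerivWithinAt (fun s => wedge fun i => variation x a i s r)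
      ((additiveCompound k (jacobian f s (x s (convexComb a r)))).mulVec
        (wedge fun i => variation x a i s r)) (Set.Icc 0 t) s := fun s hs =>
    hasDerivWithinAt_wedge fun i => hvar i s hs
  exact hN.le_exp_mul (fun s hs => (hW s hs).continuousWithinAt)
    (fun s hs => hasDerivWithinAt_Ici_of_Icc hs (hW s (Set.Ico_subset_Icc_self hs)))
    (fun s hs => hμ s hs.1 _ ((hx _ hmem).2.2 s hs.1)) t ⟨ht, le_rfl⟩

end KContraction

theorem mainTheorem1 (n k : ℕ) (hk : 1 ≤ k) (hkn : k ≤ n)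
    (f : ℝ → (Fin n → ℝ) → (Fin n → ℝ)) (Ω : Set (Fin n → ℝ))
    (hΩ_closed : IsClosed Ω) (hΩ_convex : Convex ℝ Ω)
    (hf : KContraction.IsC1InState f)
    (x : ℝ → (Fin n → ℝ) → (Fin n → ℝ)) (hx : KContraction.IsSolutionMap f Ω x)
    (η : ℝ) (hη : 0 < η)
    (N : Seminorm ℝ ((Fin k ↪o Fin n) → ℝ)) (hN : KContraction.IsVectorNorm N)
    (hμ : ∀ t : ℝ, 0 ≤ t → ∀ a ∈ Ω,
      KContraction.matrixMeasure N
        (KContraction.additiveCompound k (KContraction.jacobian f t a)) ≤ -η) :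
    KContraction.IsKOrderContractiveWith k Ω x N η ∧ KContraction.IsKOrderContractive k Ω x := by
  have h := hx.isKOrderContractiveWith hkn hΩ_convex hf hN hμ
  exact ⟨h, η, hη, N, hN, h⟩
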